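/- **Theorem 6.1.** For a weighted undirected graph $G=(V,E,w)$ with $w:E\to\mathbb R^{+}$, a hierarchical clustering tree is a finite rooted tree $\mathcal T$ (of arbitrary branching) whose leaves are in bijection with $V$. Its (Dasgupta) cost is $$\mathsf C_G(\mathcal T)=\sum_{e=\{u,v\}\in E} w(e)\cdot\bigl|\text{leaf-nodes}(\mathcal T[u\vee v])\bigr|,$$ where $u\vee v$ is the lowest common ancestor of $u$ and $v$ in $\mathcal T$ and $\text{leaf-nodes}(\mathcal T[z])$ is the set of leaves of the subtree rooted at $z$. Let $\mathrm{OPT}(G)=\min_{\mathcal T}\mathsf C_G(\mathcal T)$. A randomized single-pass streaming algorithm with $s$ bits of memory reads the edges of $G$ (with their weights) one at a time, each exactly once. Its memory takes values in $\{0,1\}^s$. The initial memory is determined by the random coins; the memory after each step is an arbitrary function of the current memory, the current edge with its weight, the coins and the number of edges read so far; and the output is an arbitrary function of the final memory, the coins and the number of edges read. There is no bound on computation time, and the coins are not charged to the memory. Then there are absolute constants $c>0$ and $n_0$ such that the following holds for every $n\ge n_0$ and every set $W$ of admissible edge weights with $1\in W$ (for instance $W=\{1\}$, the unweighted case). If a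 randomized single-pass streaming algorithm with $s$ bits of memory, for every graph $G$ on the vertex set $\{0,\dots,n-1\}$ with all edge weights in $W$ and every order of arrival of its edges, outputs exactly $\mathrm{OPT}(G)$ with probability at least $2/3$ over its coins, then $$s\ \ge\ c\,n^{2}.$$ -/

import Mathlib

open MeasureTheory

noncomputable section

/-- A weighted undirected graph `(V, E, w)` with `w : E → ℝ⁺`. Only the values of `w` on edges
are meaningful. -/
structure WeightedGraph (V : Type*) where
  graph : SimpleGraph V
  w : Sym2 V → ℝ
  w_pos : ∀ e ∈ graph.edgeSet, 0 < w e

/-- A hierarchical clustering tree on `V`: a finite rooted tree (of arbitrary branching) whose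
leaves are in bijection with `V`. In `RootedTree`, the order is the ancestor order with the root
as `⊥`; hence `x ⊓ y` is the lowest common ancestor of `x` and `y`, and the leaves are the maximal
nodes. -/
structure HCTree (V : Type*) where
  tree : RootedTree.{0}
  finite : Finite tree
  leaf : V ≃ {x : tree // IsMax x}

namespace HCTree

variable {V : Type*}

/-- The leaf-nodes of the subtree rooted at the node `z`, as a set of elements of `V`. -/
def leafNodes (T : HCTree V) (z : T.tree) : Set V :=
  {v | z ≤ (T.leaf v : T.tree)}

/-- The lowest common ancestor `u ∨ v` of the two endpoints of the pair `e = {u, v}`. -/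
def lca (T : HCTree V) (e : Sym2 V) : T.tree :=
  Sym2.lift ⟨fun u v => (T.leaf u : T.tree) ⊓ (T.leaf v : T.tree), fun _ _ => inf_comm _ _⟩ e

open Classical in
/-- Dasgupta's cost `∑_{e = {u,v} ∈ E} w(e) · |leaf-nodes(T[u ∨ v])|`. -/
def cost [Fintype V] (G : WeightedGraph V) (T : HCTree V) : ℝ :=
  ∑ e ∈ G.graph.edgeFinset, G.w e * ((T.leafNodes (T.lca e)).ncard : ℝ)

end HCTree

/-- The optimal hierarchical clustering value of `G`: the least cost of a tree on `V`. The costs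
are nonnegative and take finitely many values, and a tree exists once `V` is nonempty, so that the
infimum is a minimum. -/
def WeightedGraph.opt {V : Type*} [Fintype V] (G : WeightedGraph V) : ℝ :=
  sInf (Set.range (HCTree.cost G))

/-- `l` is a stream of `G`: it lists every edge of `G` exactly once, in some order, together with
its weight. -/
def WeightedGraph.IsStream {V : Type*} (G : WeightedGraph V) (l : List (Sym2 V × ℝ)) : Prop :=
  ∃ es : List (Sym2 V), es.Nodup ∧ (∀ e, e ∈ es ↔ e ∈ G.graph.edgeSet) ∧
    l = es.map fun e => (e, G.w e)

/-- The contents of a memory of `s` bits. -/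
abbrev Memory (s : ℕ) : Type := Fin s → Bool

/-- A randomized single-pass streaming algorithm with a memory of `s` bits, reading tokens from `X`
and returning a real number. Computation is unbounded: the update and output maps are arbitrary.
The outcome `ω` of the coin tosses and the number of tokens read so far are available at every step
and not charged to the memory, so that private coins, fresh coins at each step and shared coins are
all included. The last three fields say that the behaviour is a random variable in the coins. -/
structure StreamingAlgorithm (X Ω : Type*) [MeasurableSpace Ω] (s : ℕ) where
  init : Ω → Memory s
  step : Ω → ℕ → Memory s → X → Memory s
  output : Ω → ℕ → Memory s → ℝ
  measurable_init : Measurable init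
  measurable_step : ∀ t m x, Measurable fun ω => step ω t m x
  measurable_output : ∀ t m, Measurable fun ω => output ω t m

namespace StreamingAlgorithm

variable {X Ω : Type*} [MeasurableSpace Ω] {s : ℕ}

/-- The memory after reading the given list, from memory `m` with `t` tokens already read. -/
def runFrom (A : StreamingAlgorithm X Ω s) (ω : Ω) : ℕ → Memory s → List X → Memory s
  | _, m, [] => m
  | t, m, x :: l => A.runFrom ω (t + 1) (A.step ω t m x) l

/-- The output after one pass over the stream `l`. -/
def result (A : StreamingAlgorithm X Ω s) (ω : Ω) (l : List X) : ℝ :=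
  A.output ω l.length (A.runFrom ω 0 (A.init ω) l)

/-- On every weighted graph on `V` with all edge weights in `W`, and for every arrival order of the
edges, the algorithm outputs exactly the optimal hierarchical clustering value with probability at
least `p`. -/
def ComputesOpt {V : Type*} [Fintype V] (A : StreamingAlgorithm (Sym2 V × ℝ) Ω s)
    (μ : Measure Ω) (W : Set ℝ) (p : ℝ) : Prop :=
  ∀ G : WeightedGraph V, (∀ e ∈ G.graph.edgeSet, G.w e ∈ W) →
    ∀ l, G.IsStream l → p ≤ μ.real {ω | A.result ω l = G.opt}

end StreamingAlgorithm

end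

/-! The proof reduces from the one-way communication problem INDEX on `r ^ 2` bits with `r` linear
in `n`.

With unit weights an edge `ab` costs `n` minus the number of leaves `c` that the tree separates from
it, and of three leaves at most one pair is separated from the third. So no tree costs less than
`baseCost`, which is `n|E| - n(n-1)(n-2)/6`. If the tree first branches into `X` and `Xᶜ`, each
triple made of a nonadjacent pair in one class and a vertex of the other saves nothing, so the cost
is at least `baseCost + splitLoss X / 2` (`exists_baseCost_add_le_cost`). When each class of a
partition `P` is complete up to a star of missing edges, two caterpillars attain this bound for `X =
P`; two large sets with no edges to the opposite class make every other partition at least as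
expensive. This gives `NearlyBipartiteCompl.opt_eq`.

The code graph depends only on the bits `z`: between two copies of `Fin r × Bool`, the bit at `(j,
l)` decides which of the two perfect matchings joins the copies of `j` and `l`. The query graph
depends only on `i`: it fills two classes, obtained from the two sides by exchanging one vertex of
each. The exchanged vertices are the star centres, and they are adjacent or not according to the
queried bit. The missing edges per class then number `r` or `r - 1`, which shifts the optimum by `n`
(`opt_graph`). The memory between the two parts of the stream is thus a message solving INDEX, and
an exponential moment bound makes it linear in `r ^ 2` (`card_mul_log_le_of_agree`). -/

/-! ### Rooted trees from finite orders and from laminar families -/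

section TreeOfOrder

variable {α : Type*} [PartialOrder α] [Finite α]

theorem exists_isGreatest_of_chain (h : ∀ a b x : α, a ≤ x → b ≤ x → a ≤ b ∨ b ≤ a)
    {s : Set α} (hs : s.Nonempty) {x : α} (hx : ∀ a ∈ s, a ≤ x) : ∃ m, IsGreatest s m := by
  obtain ⟨m, hm⟩ := (Set.toFinite s).exists_maximal hs
  refine ⟨m, hm.1, fun a ha => ?_⟩
  rcases h a m x (hx a ha) (hx m hm.1) with h1 | h1
  · exact h1
  · exact hm.2 ha h1

variable [OrderBot α]

/-- A finite order with a least element in which the elements below any given one form a chain,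
as a rooted tree. -/
noncomputable def RootedTree.ofChains (h : ∀ a b x : α, a ≤ x → b ≤ x → a ≤ b ∨ b ≤ a) :
    RootedTree :=
  have hinf : ∀ a b : α, ∃ m, IsGreatest {x | x ≤ a ∧ x ≤ b} m := fun a b =>
    exists_isGreatest_of_chain h ⟨⊥, bot_le, bot_le⟩ (x := a) fun _ hx => hx.1
  -- The root is its own predecessor; any other node has its parent, the largest element strictly
  -- below it.
  have hpred : ∀ a : α, ∃ m, (a = ⊥ ∧ m = ⊥) ∨ (a ≠ ⊥ ∧ IsGreatest {x | x < a} m) := fun a => by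
    by_cases ha : a = ⊥
    · exact ⟨⊥, Or.inl ⟨ha, rfl⟩⟩
    · obtain ⟨m, hm⟩ := exists_isGreatest_of_chain h (s := {x | x < a})
        ⟨⊥, bot_lt_iff_ne_bot.2 ha⟩ (x := a) fun _ hx => le_of_lt hx
      exact ⟨m, Or.inr ⟨ha, hm⟩⟩
  letI instInf : SemilatticeInf α :=
    { ‹PartialOrder α› with
      inf := fun a b => (hinf a b).choose
      inf_le_left := fun a b => (hinf a b).choose_spec.1.1
      inf_le_right := fun a b => (hinf a b).choose_spec.1.2
      le_inf := fun _ b c hab hac => (hinf b c).choose_spec.2 ⟨hab, hac⟩ }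
  letI instPred : PredOrder α :=
    { pred := fun a => (hpred a).choose
      pred_le := fun a => by
        rcases (hpred a).choose_spec with h1 | h1
        · rw [h1.2]; exact bot_le
        · exact le_of_lt h1.2.1
      min_of_le_pred := fun {a} ha => by
        rcases (hpred a).choose_spec with h1 | h1
        · rw [h1.1]; exact isMin_bot
        · exact absurd h1.2.1 (not_lt_of_ge ha)
      le_pred_of_lt := fun {a b} hab => by
        rcases (hpred b).choose_spec with h1 | h1
        · rw [h1.1] at hab; exact absurd hab not_lt_bot
        · exact h1.2.2 hab }
  haveI : IsPredArchimedean α :=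
    { exists_pred_iterate_of_le := fun {a b} hab => by
        induction b using (Finite.wellFounded_of_trans_of_irrefl ((· < ·) : α → α → Prop)).induction with
        | _ b ih =>
          rcases eq_or_lt_of_le hab with rfl | hlt
          · exact ⟨0, rfl⟩
          · have hb : ¬ IsMin b := hlt.not_isMin
            obtain ⟨n, hn⟩ := ih (Order.pred b) (Order.pred_lt_of_not_isMin hb)
              (Order.le_pred_of_lt hlt)
            exact ⟨n + 1, hn⟩ }
  { α := α }

end TreeOfOrder

namespace HCTree

/-- The tree `T` separates `c` from the pair `a, b`: the subtree of the lowest common ancestor of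
`a` and `b` does not contain `c`. -/
def Separates {V : Type*} (T : HCTree V) (a b c : V) : Prop :=
  ¬ (T.leaf a : T.tree) ⊓ (T.leaf b : T.tree) ≤ (T.leaf c : T.tree)

/-- A laminar family of nonempty sets that contains the whole set and the singletons is the family
of the leaf sets of a tree. -/
theorem exists_of_laminar {V : Type} [Finite V] [Nonempty V] (F : Set (Set V))
    (huniv : Set.univ ∈ F) (hsing : ∀ v, {v} ∈ F) (hne : ∀ A ∈ F, A.Nonempty)
    (hlam : ∀ A ∈ F, ∀ B ∈ F, A ⊆ B ∨ B ⊆ A ∨ Disjoint A B) :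
    ∃ T : HCTree V, ∀ A ∈ F, ∀ a ∈ A, ∀ b ∈ A, ∀ c ∉ A, T.Separates a b c := by
  -- Under reverse inclusion the whole set is the root and the singletons are the maximal nodes.
  -- Nonempty members rule out disjointness of two ancestors of a node, so ancestors form a chain.
  let α : Type := {A : (Set V)ᵒᵈ // OrderDual.ofDual A ∈ F}
  let mk : ∀ A : Set V, A ∈ F → α := fun A hA => ⟨OrderDual.toDual A, hA⟩
  let car : α → Set V := fun A => OrderDual.ofDual A.1
  have hle : ∀ A B : α, A ≤ B ↔ car B ⊆ car A := fun A B => Iff.rfl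
  have hcar : ∀ A : α, car A ∈ F := fun A => A.2
  let _ : OrderBot α :=
    { bot := mk Set.univ huniv
      bot_le := fun A => Set.subset_univ (car A) }
  have : Finite α := Subtype.finite
  have hchain : ∀ a b x : α, a ≤ x → b ≤ x → a ≤ b ∨ b ≤ a := by
    intro a b x hax hbx
    rcases hlam _ (hcar a) _ (hcar b) with h | h | h
    · exact Or.inr h
    · exact Or.inl h
    · obtain ⟨y, hy⟩ := hne _ (hcar x)
      exact absurd (hbx hy) (Set.disjoint_left.1 h (hax hy))
  have hmax : ∀ v, IsMax (mk {v} (hsing v)) := by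
    intro v A hA
    obtain ⟨y, hy⟩ := hne _ (hcar A)
    have h1 : y = v := hA hy
    intro z hz
    have h2 : z = v := hz
    rw [h2, ← h1]; exact hy
  let leaf : V → {x : α // IsMax x} := fun v => ⟨mk {v} (hsing v), hmax v⟩
  have hbij : Function.Bijective leaf := by
    constructor
    · intro v w hvw
      have h1 : car (leaf v).1 = car (leaf w).1 := by rw [hvw]
      exact Set.singleton_injective h1
    · rintro ⟨A, hA⟩
      obtain ⟨y, hy⟩ := hne _ (hcar A)
      refine ⟨y, Subtype.ext (le_antisymm ?_ ?_)⟩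
      · exact hA (show A ≤ mk {y} (hsing y) from Set.singleton_subset_iff.2 hy)
      · exact Set.singleton_subset_iff.2 hy
  refine ⟨⟨RootedTree.ofChains hchain, ‹Finite α›, Equiv.ofBijective leaf hbij⟩, ?_⟩
  intro A hA a ha b hb c hc hsep
  have h1 : mk A hA ≤ (leaf c).1 :=
    le_trans (α := (RootedTree.ofChains hchain).α)
      (le_inf (α := (RootedTree.ofChains hchain).α) (Set.singleton_subset_iff.2 ha)
        (Set.singleton_subset_iff.2 hb)) hsep
  exact hc (h1 (Set.mem_singleton c))

/-! ### Separation of leaves and the first branching -/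

section Separates

variable {V : Type*} (T : HCTree V)

theorem leaf_le_leaf {a b : V} (h : (T.leaf a : T.tree) ≤ T.leaf b) : a = b := by
  have h1 : (T.leaf a : T.tree) = T.leaf b := le_antisymm h ((T.leaf a).2 h)
  exact T.leaf.injective (Subtype.ext h1)

theorem inf_leaf_total (a b c : V) :
    (T.leaf a : T.tree) ⊓ T.leaf b ≤ (T.leaf a : T.tree) ⊓ T.leaf c ∨
      (T.leaf a : T.tree) ⊓ T.leaf c ≤ (T.leaf a : T.tree) ⊓ T.leaf b :=
  le_total_of_directed inf_le_left inf_le_left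

variable {T}

theorem Separates.comm {a b c : V} (h : T.Separates a b c) : T.Separates b a c := by
  unfold Separates at *
  rwa [inf_comm]

theorem Separates.ne_left {a b c : V} (h : T.Separates a b c) : a ≠ c := by
  rintro rfl
  exact h inf_le_left

theorem Separates.ne_right {a b c : V} (h : T.Separates a b c) : b ≠ c :=
  h.comm.ne_left

/-- The meets of `b` with `a` and with `c` are comparable, and the one nearer the root lies below
all three leaves. Hence a triple has at most one separated pair, which caps what a tree can save. -/
theorem Separates.not_rotate {a b c : V} (h : T.Separates a b c) : ¬ T.Separates b c a := by
  intro h'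
  have key := T.inf_leaf_total b a c
  rcases key with h1 | h1
  · exact h.comm (h1.trans inf_le_right)
  · exact h' (h1.trans inf_le_right)

theorem Separates.not_rotate' {a b c : V} (h : T.Separates a b c) : ¬ T.Separates c a b :=
  fun h' => h'.not_rotate h

variable (T)

/-- The first branching of a tree: there is a partition of the leaves into two nonempty classes such
that no pair of leaves from different classes is separated from a third leaf, and every pair in the
first class is separated from every leaf of the second class. -/
theorem exists_split [Finite V] [Nontrivial V] :
    ∃ X : Set V, X.Nonempty ∧ Xᶜ.Nonempty ∧
      (∀ x ∈ X, ∀ x' ∈ X, ∀ y ∉ X, T.Separates x x' y) ∧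
      (∀ x ∈ X, ∀ y ∉ X, ∀ z, ¬ T.Separates x y z) := by
  obtain ⟨a, a', haa'⟩ := exists_pair_ne V
  let m : V → T.tree := fun x => (T.leaf a : T.tree) ⊓ T.leaf x
  -- The least meet with `a` lies below every leaf: it is the highest node where leaves diverge.
  obtain ⟨y₀, hy₀⟩ : ∃ y, ∀ x, m y ≤ m x := by
    obtain ⟨w, ⟨y, rfl⟩, hy⟩ := (Set.finite_range m).exists_minimal (Set.range_nonempty m)
    refine ⟨y, fun x => ?_⟩
    rcases T.inf_leaf_total a y x with h | h
    · exact h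
    · exact hy ⟨x, rfl⟩ h
  have hX : ∀ x y, (∃ z, T.Separates a x z) → (¬ ∃ z, T.Separates a y z) →
      ¬ m x ≤ T.leaf y := by
    rintro x y ⟨z, hz⟩ hy hle
    push Not at hy
    have h1 : m y ≤ T.leaf z := not_not.1 (hy z)
    exact hz ((le_inf inf_le_left hle).trans h1)
  -- The class consists of the leaves under the same child of that node as `a`: their meet with `a`
  -- misses some leaf.
  refine ⟨{x | ∃ z, T.Separates a x z}, ⟨a, a', ?_⟩, ⟨y₀, ?_⟩, ?_, ?_⟩
  · intro h
    rw [inf_idem] at h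
    exact haa' (T.leaf_le_leaf h)
  · rintro ⟨z, hz⟩
    exact hz ((hy₀ z).trans inf_le_right)
  · intro x hx x' hx' y hy h
    rcases T.inf_leaf_total a x x' with h1 | h1
    · exact hX x y hx hy ((le_inf inf_le_right (h1.trans inf_le_right)).trans h)
    · exact hX x' y hx' hy ((le_inf (h1.trans inf_le_right) inf_le_right).trans h)
  · intro x hx y hy z h
    have h0 : ∀ z, m y ≤ T.leaf z := fun z => by
      by_contra hz
      exact hy ⟨z, hz⟩
    rcases T.inf_leaf_total x a y with h1 | h1
    · refine hX x y hx hy ?_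
      rw [show m x = (T.leaf x : T.tree) ⊓ T.leaf a from inf_comm _ _]
      exact h1.trans inf_le_right
    · refine h (le_trans ?_ (h0 z))
      exact le_inf (h1.trans inf_le_right) inf_le_right

end Separates

end HCTree

/-! ### The cost of a tree in terms of triples -/

open Classical in
theorem SimpleGraph.two_mul_sum_edgeFinset {V : Type*} [Fintype V] (G : SimpleGraph V)
    (g : Sym2 V → ℝ) :
    2 * ∑ e ∈ G.edgeFinset, g e = ∑ a, ∑ b, if G.Adj a b then g s(a, b) else 0 := by
  have h1 : ∑ d : G.Dart, g d.edge = 2 * ∑ e ∈ G.edgeFinset, g e := by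
    rw [← Finset.sum_fiberwise_of_maps_to (s := Finset.univ) (t := G.edgeFinset)
      (g := fun d : G.Dart => d.edge) (fun d _ => by simp [SimpleGraph.mem_edgeFinset]),
      Finset.mul_sum]
    refine Finset.sum_congr rfl fun e he => ?_
    rw [Finset.sum_congr rfl (g := fun _ => g e)
      (fun d hd => by rw [(Finset.mem_filter.1 hd).2])]
    rw [Finset.sum_const, G.dart_edge_fiber_card e (SimpleGraph.mem_edgeFinset.1 he)]
    simp
  rw [← h1, ← Fintype.sum_prod_type' (f := fun a b => if G.Adj a b then g s(a, b) else 0),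
    ← Finset.sum_filter]
  refine Finset.sum_bij (fun d _ => d.toProd) (fun d _ => by simp [d.adj]) ?_ ?_ ?_
  · intro d _ d' _ h
    exact SimpleGraph.Dart.ext d d' h
  · intro p hp
    exact ⟨⟨p, (Finset.mem_filter.1 hp).2⟩, Finset.mem_univ _, rfl⟩
  · intro d _
    rfl

namespace WeightedGraph

variable {V : Type*} [Fintype V]

section

variable (G : WeightedGraph V)

/-- The graph has unit weights. -/
def IsUnit : Prop := ∀ e ∈ G.graph.edgeSet, G.w e = 1

open Classical in
/-- The cost that a binary tree would have if it separated no leaf from two nonadjacent leaves. -/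
noncomputable def baseCost : ℝ :=
  (Fintype.card V : ℝ) * G.graph.edgeFinset.card -
    (Fintype.card V : ℝ) * (Fintype.card V - 1) * (Fintype.card V - 2) / 6

open Classical in
/-- The number of ordered pairs of distinct nonadjacent vertices inside `X`. -/
noncomputable def nonadjCard (X : Finset V) : ℕ :=
  ((X ×ˢ X).filter fun p => G.graphᶜ.Adj p.1 p.2).card

/-- Twice the excess of the cost of a tree that branches first into `X` and its complement, and
then loses nothing more. -/
noncomputable def splitLoss [DecidableEq V] (X : Finset V) : ℕ :=
  G.nonadjCard X * Xᶜ.card + G.nonadjCard Xᶜ * X.card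

/-- The pair `a, b` is nonadjacent, lies in one class of the partition `X, Xᶜ`, and `c` lies in the
other class. -/
def Bad (X : Finset V) (a b c : V) : Prop :=
  G.graphᶜ.Adj a b ∧ ((a ∈ X ∧ b ∈ X ∧ c ∉ X) ∨ (a ∉ X ∧ b ∉ X ∧ c ∈ X))

end

open Classical in
theorem sum_bad [DecidableEq V] (G : WeightedGraph V) (X : Finset V) :
    ∑ a, ∑ b, ∑ c, (if G.Bad X a b c then (1 : ℝ) else 0) = G.splitLoss X := by
  have h1 : ∀ a b c : V, (if G.Bad X a b c then (1 : ℝ) else 0) =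
      (if a ∈ X then if b ∈ X then if G.graphᶜ.Adj a b then 1 else 0 else 0 else 0) *
        (if c ∈ Xᶜ then 1 else 0) +
      (if a ∈ Xᶜ then if b ∈ Xᶜ then if G.graphᶜ.Adj a b then 1 else 0 else 0 else 0) *
        (if c ∈ X then 1 else 0) := by
    intro a b c
    unfold Bad
    by_cases ha : a ∈ X <;> by_cases hb : b ∈ X <;> by_cases hc : c ∈ X <;>
      by_cases hab : G.graphᶜ.Adj a b <;> simp [ha, hb, hc, hab]
  have h2 : ∀ Y : Finset V, ∑ a, ∑ b,
      (if a ∈ Y then if b ∈ Y then if G.graphᶜ.Adj a b then (1 : ℝ) else 0 else 0 else 0) =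
      G.nonadjCard Y := by
    intro Y
    unfold nonadjCard
    rw [Finset.card_filter, Finset.sum_product]
    push_cast
    rw [← Finset.sum_filter_add_sum_filter_not Finset.univ (· ∈ Y)]
    rw [Finset.sum_eq_zero (s := Finset.univ.filter (· ∉ Y))]
    · simp only [Finset.filter_univ_mem, add_zero]
      refine Finset.sum_congr rfl fun a ha => ?_
      simp only [if_pos ha]
      rw [← Finset.sum_filter]
      simp
    · intro a ha
      simp [(Finset.mem_filter.1 ha).2]
  have h3 : ∀ Y : Finset V, ∑ c, (if c ∈ Y then (1 : ℝ) else 0) = Y.card := fun Y => by simp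
  simp_rw [h1, Finset.sum_add_distrib, ← Finset.mul_sum, ← Finset.sum_mul, h2, h3]
  simp [splitLoss]

open Classical in
theorem sum_distinct :
    ∑ a : V, ∑ b : V, ∑ c : V, (if a ≠ b ∧ b ≠ c ∧ a ≠ c then (1 : ℝ) else 0) =
      (Fintype.card V : ℝ) * (Fintype.card V - 1) * (Fintype.card V - 2) := by
  have h1 : ∀ a b c : V, (if a ≠ b ∧ b ≠ c ∧ a ≠ c then (1 : ℝ) else 0) =
      1 - (if a = b then 1 else 0) - (if b = c then 1 else 0) - (if a = c then 1 else 0) +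
        2 * ((if a = b then 1 else 0) * (if b = c then 1 else 0)) := by
    intro a b c
    by_cases hab : a = b <;> by_cases hbc : b = c <;> by_cases hac : a = c <;>
      simp_all [show (-1 - 1 + 2 : ℝ) = 0 by norm_num]
  simp_rw [h1, Finset.sum_add_distrib, Finset.sum_sub_distrib, ← Finset.mul_sum]
  simp
  ring

open Classical in
theorem sum_cyclic (Q : V → V → V → Prop) :
    ∑ a, ∑ b, ∑ c, ((if Q a b c then (1 : ℝ) else 0) + (if Q b c a then 1 else 0) +
      (if Q c a b then 1 else 0)) = 3 * ∑ a, ∑ b, ∑ c, if Q a b c then (1 : ℝ) else 0 := by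
  have h1 : ∀ F : V → V → V → ℝ, ∑ a, ∑ b, ∑ c, F b c a = ∑ a, ∑ b, ∑ c, F a b c := by
    intro F
    rw [Finset.sum_comm]
    refine Finset.sum_congr rfl fun a _ => ?_
    rw [Finset.sum_comm]
  simp_rw [Finset.sum_add_distrib]
  rw [h1 fun a b c => if Q a b c then (1 : ℝ) else 0,
    ← h1 fun a b c => if Q c a b then (1 : ℝ) else 0]
  ring

open Classical in
-- At most one of the three rotations of a triple satisfies `Q`, and only if its entries are
-- distinct.
theorem three_mul_sum_le (Q : V → V → V → Prop)
    (hQ : ∀ a b c, Q a b c → (a ≠ b ∧ b ≠ c ∧ a ≠ c) ∧ ¬ Q b c a ∧ ¬ Q c a b) :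
    3 * ∑ a, ∑ b, ∑ c, (if Q a b c then (1 : ℝ) else 0) ≤
      (Fintype.card V : ℝ) * (Fintype.card V - 1) * (Fintype.card V - 2) := by
  rw [← sum_cyclic, ← sum_distinct]
  refine Finset.sum_le_sum fun a _ => Finset.sum_le_sum fun b _ => Finset.sum_le_sum fun c _ => ?_
  by_cases h1 : Q a b c
  · simp [h1, hQ a b c h1]
  by_cases h2 : Q b c a
  · have h := hQ b c a h2
    simp [h2, h.2, h.1.1, h.1.2.1.symm, h.1.2.2.symm]
  by_cases h3 : Q c a b
  · have h := hQ c a b h3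
    simp [h3, h.2, h.1.1.symm, h.1.2.1, h.1.2.2.symm]
  rw [if_neg h1, if_neg h2, if_neg h3]
  split_ifs <;> norm_num

open Classical in
theorem le_three_mul_sum (Q : V → V → V → Prop)
    (hQ : ∀ a b c, a ≠ b → b ≠ c → a ≠ c → Q a b c ∨ Q b c a ∨ Q c a b) :
    (Fintype.card V : ℝ) * (Fintype.card V - 1) * (Fintype.card V - 2) ≤
      3 * ∑ a, ∑ b, ∑ c, (if Q a b c then (1 : ℝ) else 0) := by
  rw [← sum_cyclic, ← sum_distinct]
  refine Finset.sum_le_sum fun a _ => Finset.sum_le_sum fun b _ => Finset.sum_le_sum fun c _ => ?_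
  by_cases hd : a ≠ b ∧ b ≠ c ∧ a ≠ c
  · rw [if_pos hd]
    have := hQ a b c hd.1 hd.2.1 hd.2.2
    split_ifs <;> first | tauto | norm_num
  · rw [if_neg hd]
    split_ifs <;> norm_num

open Classical in
-- The leaves under the lowest common ancestor of an edge are those not separated from it; the
-- factor 2 counts each edge as two ordered pairs.
theorem two_mul_cost (G : WeightedGraph V) (hG : G.IsUnit) (T : HCTree V) :
    2 * T.cost G = 2 * ((Fintype.card V : ℝ) * G.graph.edgeFinset.card) -
      ∑ a, ∑ b, ∑ c, (if G.graph.Adj a b ∧ T.Separates a b c then (1 : ℝ) else 0) := by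
  have hE := G.graph.two_mul_sum_edgeFinset (fun _ => (Fintype.card V : ℝ))
  rw [Finset.sum_const, nsmul_eq_mul, mul_comm (_ : ℝ) (Fintype.card V : ℝ)] at hE
  unfold HCTree.cost
  rw [SimpleGraph.two_mul_sum_edgeFinset, hE, ← Finset.sum_sub_distrib]
  refine Finset.sum_congr rfl fun a _ => ?_
  rw [← Finset.sum_sub_distrib]
  refine Finset.sum_congr rfl fun b _ => ?_
  by_cases hab : G.graph.Adj a b
  · simp only [hab, if_true, true_and]
    rw [hG s(a, b) hab, one_mul, Set.ncard_eq_toFinset_card', eq_sub_iff_add_eq,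
      ← Finset.natCast_card_filter, ← Nat.cast_add, ← Finset.card_univ,
      ← Finset.card_filter_add_card_filter_not (s := Finset.univ) (fun c => T.Separates a b c),
      add_comm]
    congr 3
    ext c
    rw [Set.mem_toFinset]
    simp [HCTree.leafNodes, HCTree.lca, HCTree.Separates]
  · simp [hab]

/-- Either the tree `T` splits `c` off from the edge `a, b`, or the triple is lost to the partition
`X, Xᶜ`. -/
def Resolved (G : WeightedGraph V) (T : HCTree V) (X : Finset V) (a b c : V) : Prop :=
  (G.graph.Adj a b ∧ T.Separates a b c) ∨ G.Bad X a b c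

open Classical in
-- Savings concern adjacent pairs and losses nonadjacent ones, so the two never overlap on `a b c`.
-- A single count of resolved triples then yields both the lower and the upper bound on the cost.
theorem two_mul_cost_eq_sum_resolved [DecidableEq V] (G : WeightedGraph V) (hG : G.IsUnit) (T : HCTree V)
    (X : Finset V) :
    2 * T.cost G = 2 * ((Fintype.card V : ℝ) * G.graph.edgeFinset.card) + G.splitLoss X -
      ∑ a, ∑ b, ∑ c, (if G.Resolved T X a b c then (1 : ℝ) else 0) := by
  have h : ∀ a b c, (if G.Resolved T X a b c then (1 : ℝ) else 0) =
      (if G.graph.Adj a b ∧ T.Separates a b c then (1 : ℝ) else 0) +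
        (if G.Bad X a b c then (1 : ℝ) else 0) := by
    intro a b c
    unfold Resolved
    by_cases h1 : G.Bad X a b c
    · have h2 : ¬ G.graph.Adj a b := ((SimpleGraph.compl_adj _ _ _).1 h1.1).2
      simp [h1, h2]
    · simp [h1]
  simp_rw [h, Finset.sum_add_distrib]
  rw [sum_bad, two_mul_cost G hG T]
  ring

/-- The cost of every tree is at least the base cost plus the loss of some partition. -/
theorem exists_baseCost_add_le_cost [DecidableEq V] [Nontrivial V] (G : WeightedGraph V) (hG : G.IsUnit)
    (T : HCTree V) :
    ∃ X : Finset V, X.Nonempty ∧ X ≠ Finset.univ ∧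
      G.baseCost + (G.splitLoss X : ℝ) / 2 ≤ T.cost G := by
  classical
  obtain ⟨Y, hY, hYc, hin, hout⟩ := T.exists_split
  obtain ⟨X, rfl⟩ : ∃ X : Finset V, Y = X := ⟨Y.toFinset, by simp⟩
  simp only [Finset.mem_coe] at hin hout
  refine ⟨X, by simpa using hY, ?_, ?_⟩
  · rintro rfl
    simp at hYc
  -- In a bad triple the other two pairs cross the partition, so neither is separated from the third
  -- leaf.
  have hsep : ∀ a b c, G.Bad X a b c → ¬ T.Separates b c a ∧ ¬ T.Separates c a b := by
    rintro a b c ⟨-, ⟨ha, hb, hc⟩ | ⟨ha, hb, hc⟩⟩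
    · exact ⟨hout b hb c hc a, fun h' => hout a ha c hc b h'.comm⟩
    · exact ⟨fun h' => hout c hc b hb a h'.comm, hout c hc a ha b⟩
  have hbad : ∀ a b c, G.Bad X a b c → ¬ G.Bad X b c a ∧ ¬ G.Bad X c a b := by
    rintro a b c ⟨-, h⟩
    unfold Bad
    tauto
  have hsum := three_mul_sum_le (G.Resolved T X) (by
    rintro a b c (⟨hab, h⟩ | h)
    · refine ⟨⟨hab.ne, h.ne_right, h.ne_left⟩, ?_, ?_⟩
      · rintro (⟨-, h'⟩ | h')
        · exact h.not_rotate h'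
        · exact (hsep _ _ _ h').2 h
      · rintro (⟨-, h'⟩ | h')
        · exact h.not_rotate' h'
        · exact (hsep _ _ _ h').1 h
    · refine ⟨⟨h.1.ne, ?_, ?_⟩, ?_, ?_⟩
      · rintro rfl
        have := h.2
        tauto
      · rintro rfl
        have := h.2
        tauto
      · rintro (⟨-, h'⟩ | h')
        · exact (hsep _ _ _ h).1 h'
        · exact (hbad _ _ _ h).1 h'
      · rintro (⟨-, h'⟩ | h')
        · exact (hsep _ _ _ h).2 h'
        · exact (hbad _ _ _ h).2 h')
  have h2 := two_mul_cost_eq_sum_resolved G hG T X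
  unfold baseCost
  linarith

/-- If every triple of leaves is split off along an edge or is lost to the partition, then the cost
is at most the base cost plus the loss of the partition. -/
theorem cost_le_baseCost_add [DecidableEq V] (G : WeightedGraph V) (hG : G.IsUnit) (T : HCTree V) (X : Finset V)
    (h : ∀ a b c, a ≠ b → b ≠ c → a ≠ c →
      G.Resolved T X a b c ∨ G.Resolved T X b c a ∨ G.Resolved T X c a b) :
    T.cost G ≤ G.baseCost + (G.splitLoss X : ℝ) / 2 := by
  have hsum := le_three_mul_sum _ h
  have h2 := two_mul_cost_eq_sum_resolved G hG T X
  unfold baseCost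
  linarith

end WeightedGraph

/-! ### Graphs whose optimal tree branches first into two given classes -/

namespace WeightedGraph

variable {V : Type*}

theorem splitLoss_compl [Fintype V] [DecidableEq V] (G : WeightedGraph V) (X : Finset V) : G.splitLoss Xᶜ = G.splitLoss X := by
  rw [splitLoss, splitLoss, compl_compl, add_comm]

theorem two_mul_card_mul_card_le_nonadjCard (G : WeightedGraph V) {A B X : Finset V} (hA : A ⊆ X) (hB : B ⊆ X)
    (hAB : ∀ a ∈ A, ∀ b ∈ B, G.graphᶜ.Adj a b) :
    2 * (A.card * B.card) ≤ G.nonadjCard X := by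
  classical
  have hdisj : ∀ a ∈ A, a ∉ B := fun a ha hb => (hAB a ha a hb).ne rfl
  have h1 : Disjoint (A ×ˢ B) (B ×ˢ A) := by
    rw [Finset.disjoint_left]
    rintro ⟨a, b⟩ h h'
    exact hdisj a (Finset.mem_product.1 h).1 (Finset.mem_product.1 h').1
  have h2 : (A ×ˢ B ∪ B ×ˢ A).card ≤ G.nonadjCard X := by
    unfold nonadjCard
    refine Finset.card_le_card fun p hp => ?_
    rw [Finset.mem_filter, Finset.mem_product]
    rcases Finset.mem_union.1 hp with h | h <;> obtain ⟨ha, hb⟩ := Finset.mem_product.1 h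
    · exact ⟨⟨hA ha, hB hb⟩, hAB _ ha _ hb⟩
    · exact ⟨⟨hB ha, hA hb⟩, (hAB _ hb _ ha).symm⟩
  rw [Finset.card_union_of_disjoint h1, Finset.card_product, Finset.card_product] at h2
  linarith [mul_comm A.card B.card]

variable [Fintype V] [DecidableEq V] (G : WeightedGraph V)

/-- The complement of `G` is close to bipartite: each of the two classes `P` and `Pᶜ` contains a
large set, joined completely to the other class in the complement, and all the nonadjacent pairs
inside a class go through one vertex. -/
structure NearlyBipartiteCompl (P KP KQ : Finset V) (v u : V) : Prop where
  subset_left : KP ⊆ P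
  subset_right : KQ ⊆ Pᶜ
  adj_right : ∀ p ∈ P, ∀ q ∈ KQ, G.graphᶜ.Adj p q
  adj_left : ∀ p ∈ KP, ∀ q ∈ Pᶜ, G.graphᶜ.Adj p q
  mem_left : v ∈ P
  mem_right : u ∉ P
  star_left : ∀ a ∈ P, ∀ b ∈ P, G.graphᶜ.Adj a b → a = v ∨ b = v
  star_right : ∀ a ∉ P, ∀ b ∉ P, G.graphᶜ.Adj a b → a = u ∨ b = u

variable {G} {P KP KQ : Finset V} {v u : V}

/-- One misplaced vertex is nonadjacent to at least `k` vertices on its side of `X`. That is `2 * k`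
ordered pairs, each lost to at least `k` vertices opposite. -/
theorem NearlyBipartiteCompl.eq_of_subset (h : G.NearlyBipartiteCompl P KP KQ v u) {k : ℕ}
    (hKP : k ≤ KP.card) (hKQ : k ≤ KQ.card) {X : Finset V} (hX : G.splitLoss X < 2 * (k * k))
    (hPX : KP ⊆ X) (hQX : KQ ⊆ Xᶜ) : X = P := by
  have hkX : k ≤ X.card := hKP.trans (Finset.card_le_card hPX)
  have hkX' : k ≤ Xᶜ.card := hKQ.trans (Finset.card_le_card hQX)
  ext w
  by_contra hw
  rcases (by tauto : (w ∈ X ∧ w ∉ P) ∨ (w ∉ X ∧ w ∈ P)) with ⟨h1, h2⟩ | ⟨h1, h2⟩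
  · have := two_mul_card_mul_card_le_nonadjCard G hPX (Finset.singleton_subset_iff.2 h1)
      (fun a ha b hb => h.adj_left a ha b (by simpa [Finset.mem_singleton.1 hb] using h2))
    rw [Finset.card_singleton, mul_one] at this
    have h3 : 2 * k * k ≤ G.nonadjCard X * Xᶜ.card := Nat.mul_le_mul (by omega) hkX'
    rw [splitLoss] at hX
    nlinarith [Nat.zero_le (G.nonadjCard Xᶜ * X.card)]
  · have := two_mul_card_mul_card_le_nonadjCard G hQX
      (Finset.singleton_subset_iff.2 (Finset.mem_compl.2 h1))
      (fun a ha b hb => (h.adj_right b (by simpa [Finset.mem_singleton.1 hb] using h2) a ha).symm)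
    rw [Finset.card_singleton, mul_one] at this
    have h3 : 2 * k * k ≤ G.nonadjCard Xᶜ * X.card := Nat.mul_le_mul (by omega) hkX
    rw [splitLoss] at hX
    nlinarith [Nat.zero_le (G.nonadjCard X * Xᶜ.card)]

theorem sub_one_le_mul_of_le_add {k p₁ p₂ : ℕ} (h : k ≤ p₁ + p₂) (h₁ : 0 < p₁) (h₂ : 0 < p₂) :
    k - 1 ≤ p₁ * p₂ := by
  obtain ⟨a, rfl⟩ := Nat.exists_eq_add_of_lt h₁
  obtain ⟨b, rfl⟩ := Nat.exists_eq_add_of_lt h₂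
  have : k - 1 ≤ a + b + 1 := by omega
  nlinarith [Nat.zero_le (a * b)]

/-- Here `p₁, p₂` and `q₁, q₂` count how `X` and `Xᶜ` cut `KP` and `KQ`, and `a, b` are the sizes of
`X, Xᶜ`. The loss is at least `p₁ p₂ (q₁ + q₂) + q₁ q₂ (p₁ + p₂)`, so cutting either set costs `(k -
1) k`; leaving both uncut on one side costs `k * k`, as the other side is nonempty. -/
theorem cross_counts {k p₁ p₂ q₁ q₂ a b : ℕ} (hp : k ≤ p₁ + p₂) (hq : k ≤ q₁ + q₂)
    (ha : p₁ + q₁ ≤ a) (hb : p₂ + q₂ ≤ b) (ha0 : 0 < a) (hb0 : 0 < b)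
    (h : p₁ * q₁ * b + p₂ * q₂ * a < k * (k - 1)) : (p₂ = 0 ∧ q₁ = 0) ∨ (p₁ = 0 ∧ q₂ = 0) := by
  have h1 : p₁ * q₁ * (p₂ + q₂) + p₂ * q₂ * (p₁ + q₁) < k * (k - 1) :=
    lt_of_le_of_lt (Nat.add_le_add (Nat.mul_le_mul_left _ hb) (Nat.mul_le_mul_left _ ha)) h
  have hp' : p₁ = 0 ∨ p₂ = 0 := by
    by_contra! hne
    have h2 := sub_one_le_mul_of_le_add hp (Nat.pos_of_ne_zero hne.1) (Nat.pos_of_ne_zero hne.2)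
    have h3 := Nat.mul_le_mul hq h2
    nlinarith [Nat.zero_le (q₁ * q₂ * (p₁ + p₂))]
  have hq' : q₁ = 0 ∨ q₂ = 0 := by
    by_contra! hne
    have h2 := sub_one_le_mul_of_le_add hq (Nat.pos_of_ne_zero hne.1) (Nat.pos_of_ne_zero hne.2)
    have h3 := Nat.mul_le_mul hp h2
    nlinarith [Nat.zero_le (p₁ * p₂ * (q₁ + q₂))]
  have hkk : k * (k - 1) ≤ k * k := Nat.mul_le_mul_left _ (Nat.sub_le _ _)
  rcases hp' with rfl | rfl <;> rcases hq' with rfl | rfl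
  · exfalso
    have h3 := Nat.mul_le_mul (show k ≤ p₂ by omega) (show k ≤ q₂ by omega)
    nlinarith [Nat.mul_le_mul h3 (show 1 ≤ a from ha0)]
  · exact Or.inr ⟨rfl, rfl⟩
  · exact Or.inl ⟨rfl, rfl⟩
  · exfalso
    have h3 := Nat.mul_le_mul (show k ≤ p₁ by omega) (show k ≤ q₁ by omega)
    nlinarith [Nat.mul_le_mul h3 (show 1 ≤ b from hb0)]

/-- A cheaper partition would have to put `KP` and `KQ` whole on opposite sides, by `cross_counts`,
and then no vertex could be misplaced, so it would be `P, Pᶜ` itself. -/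
theorem NearlyBipartiteCompl.splitLoss_le (h : G.NearlyBipartiteCompl P KP KQ v u) {k : ℕ}
    (hKP : k ≤ KP.card) (hKQ : k ≤ KQ.card) (hP : G.splitLoss P ≤ 2 * (k * (k - 1)))
    {X : Finset V} (hne : X.Nonempty) (hne' : X ≠ Finset.univ) :
    G.splitLoss P ≤ G.splitLoss X := by
  by_contra! hlt
  have hadj : ∀ p ∈ KP, ∀ q ∈ KQ, G.graphᶜ.Adj p q := fun p hp q hq =>
    h.adj_right p (h.subset_left hp) q hq
  have hX1 := two_mul_card_mul_card_le_nonadjCard G (A := KP ∩ X) (B := KQ ∩ X)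
    Finset.inter_subset_right Finset.inter_subset_right
    (fun a ha b hb => hadj a (Finset.mem_inter.1 ha).1 b (Finset.mem_inter.1 hb).1)
  have hX2 := two_mul_card_mul_card_le_nonadjCard G (A := KP ∩ Xᶜ) (B := KQ ∩ Xᶜ)
    Finset.inter_subset_right Finset.inter_subset_right
    (fun a ha b hb => hadj a (Finset.mem_inter.1 ha).1 b (Finset.mem_inter.1 hb).1)
  have hcard : ∀ K : Finset V, K.card = (K ∩ X).card + (K ∩ Xᶜ).card := fun K => by
    rw [← Finset.card_inter_add_card_sdiff K X, Finset.sdiff_eq_inter_compl]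
  have hdisj : Disjoint KP KQ := by
    rw [Finset.disjoint_left]
    exact fun a ha hb => (hadj a ha a hb).ne rfl
  have hsub : ∀ Y : Finset V, (KP ∩ Y).card + (KQ ∩ Y).card ≤ Y.card := fun Y => by
    rw [← Finset.card_union_of_disjoint
      (hdisj.mono Finset.inter_subset_left Finset.inter_subset_left)]
    exact Finset.card_le_card (Finset.union_subset Finset.inter_subset_right
      Finset.inter_subset_right)
  have hpos : 0 < Xᶜ.card := by
    rw [Finset.card_pos, Finset.nonempty_iff_ne_empty]
    simpa using hne'
  have hkk : k * (k - 1) ≤ k * k := Nat.mul_le_mul_left _ (Nat.sub_le _ _)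
  have hlt' : G.splitLoss X < 2 * (k * k) := by omega
  have hsplit : 2 * ((KP ∩ X).card * (KQ ∩ X).card * Xᶜ.card +
      (KP ∩ Xᶜ).card * (KQ ∩ Xᶜ).card * X.card) ≤ G.splitLoss X := by
    have h1 := Nat.mul_le_mul_right Xᶜ.card hX1
    have h2 := Nat.mul_le_mul_right X.card hX2
    rw [splitLoss]
    linarith
  have hempty : ∀ K Y : Finset V, (K ∩ Y).card = 0 → K ⊆ Yᶜ := fun K Y h0 w hw => by
    rw [Finset.mem_compl]
    intro hwY
    rw [Finset.card_eq_zero] at h0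
    exact Finset.notMem_empty w (h0 ▸ Finset.mem_inter.2 ⟨hw, hwY⟩)
  rcases cross_counts (hKP.trans (hcard KP).le) (hKQ.trans (hcard KQ).le) (hsub X) (hsub Xᶜ)
    hne.card_pos hpos (by omega) with ⟨h1, h2⟩ | ⟨h1, h2⟩
  · have := h.eq_of_subset hKP hKQ hlt' (by simpa using hempty _ _ h1) (hempty _ _ h2)
    rw [this] at hlt
    exact lt_irrefl _ hlt
  · have := h.eq_of_subset hKP hKQ (X := Xᶜ) (by rwa [splitLoss_compl]) (hempty _ _ h1)
      (hempty _ _ h2)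
    rw [← this, splitLoss_compl] at hlt
    exact lt_irrefl _ hlt

end WeightedGraph

/-! ### The optimal tree -/

namespace WeightedGraph

variable {V : Type} [Fintype V] [DecidableEq V] {G : WeightedGraph V} {P KP KQ : Finset V} {v u : V}

/-- Two caterpillars, one on each class, joined at the root. -/
theorem NearlyBipartiteCompl.exists_cost_le (h : G.NearlyBipartiteCompl P KP KQ v u)
    (hG : G.IsUnit) : ∃ T : HCTree V, T.cost G ≤ G.baseCost + (G.splitLoss P : ℝ) / 2 := by
  classical
  let e := Fintype.equivFin V
  -- The rank is the order in which a caterpillar sheds its leaves. Each star centre has rank 0 and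
  -- goes first, so the vertices left in its class are pairwise adjacent. Injectivity is needed only
  -- within a class.
  let ρ : V → ℕ := fun x => if x = v ∨ x = u then 0 else (e x : ℕ) + 1
  have hinj : ∀ x y, ρ x = ρ y → (x ∈ P ↔ y ∈ P) → x = y := by
    intro x y hxy hP
    have hv := h.mem_left
    have hu := h.mem_right
    simp only [ρ] at hxy
    split_ifs at hxy with h1 h2 h2
    · rcases h1 with rfl | rfl <;> rcases h2 with rfl | rfl <;> tauto
    · exact e.injective (Fin.ext (by omega))
  have hmin : ∀ x y, (x = v ∨ x = u) → ¬ ρ y < ρ x := by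
    intro x y hx
    simp [ρ, hx]
  let F : Set (Set V) := {A | A.Nonempty ∧ (A = Set.univ ∨ (∃ x, A = {x}) ∨
    (∃ t, A = {x | x ∈ P ∧ t ≤ ρ x}) ∨ (∃ t, A = {x | x ∉ P ∧ t ≤ ρ x}))}
  have : Nonempty V := ⟨v⟩
  obtain ⟨T, hT⟩ := HCTree.exists_of_laminar F ⟨Set.univ_nonempty, Or.inl rfl⟩
    (fun x => ⟨Set.singleton_nonempty x, Or.inr (Or.inl ⟨x, rfl⟩)⟩) (fun A hA => hA.1) (by
      have hs : ∀ (x : V) (B : Set V), {x} ⊆ B ∨ Disjoint {x} B := fun x B => by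
        by_cases hx : x ∈ B
        · exact Or.inl (Set.singleton_subset_iff.2 hx)
        · exact Or.inr (Set.disjoint_singleton_left.2 hx)
      have hs' : ∀ (x : V) (B : Set V), {x} ⊆ B ∨ Disjoint B {x} := fun x B =>
        (hs x B).imp_right fun hd => hd.symm
      rintro A ⟨-, rfl | ⟨x, rfl⟩ | ⟨t, rfl⟩ | ⟨t, rfl⟩⟩ B ⟨-, rfl | ⟨y, rfl⟩ | ⟨t', rfl⟩ | ⟨t', rfl⟩⟩
      any_goals exact Or.inl (Set.subset_univ _)
      any_goals exact Or.inr (Or.inl (Set.subset_univ _))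
      any_goals exact (hs _ _).imp_right Or.inr
      any_goals exact Or.inr (hs' _ _)
      · rcases le_total t t' with h1 | h1
        · exact Or.inr (Or.inl fun x hx => ⟨hx.1, h1.trans hx.2⟩)
        · exact Or.inl fun x hx => ⟨hx.1, h1.trans hx.2⟩
      · exact Or.inr (Or.inr (Set.disjoint_left.2 fun x hx hx' => hx'.1 hx.1))
      · exact Or.inr (Or.inr (Set.disjoint_left.2 fun x hx hx' => hx.1 hx'.1))
      · rcases le_total t t' with h1 | h1
        · exact Or.inr (Or.inl fun x hx => ⟨hx.1, h1.trans hx.2⟩)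
        · exact Or.inl fun x hx => ⟨hx.1, h1.trans hx.2⟩)
  have hcross : ∀ a b c, a ≠ b → (a ∈ P ↔ b ∈ P) → ¬ (a ∈ P ↔ c ∈ P) →
      G.Resolved T P a b c := by
    intro a b c hab h1 h2
    by_cases hadj : G.graph.Adj a b
    · refine Or.inl ⟨hadj, ?_⟩
      by_cases ha : a ∈ P
      · exact hT {x | x ∈ P ∧ 0 ≤ ρ x} ⟨⟨a, ha, Nat.zero_le _⟩, Or.inr (Or.inr (Or.inl ⟨0, rfl⟩))⟩
          a ⟨ha, Nat.zero_le _⟩ b ⟨h1.1 ha, Nat.zero_le _⟩ c (fun hc => by have := hc.1; tauto)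
      · exact hT {x | x ∉ P ∧ 0 ≤ ρ x} ⟨⟨a, ha, Nat.zero_le _⟩, Or.inr (Or.inr (Or.inr ⟨0, rfl⟩))⟩
          a ⟨ha, Nat.zero_le _⟩ b ⟨fun hb => ha (h1.2 hb), Nat.zero_le _⟩ c
          (fun hc => by have := hc.1; tauto)
    · exact Or.inr ⟨(SimpleGraph.compl_adj _ _ _).2 ⟨hab, hadj⟩, by tauto⟩
  -- Within a class the vertex of least rank is shed first; the other two are not centres, hence
  -- adjacent, and the threshold `ρ c + 1` separates them from `c`.
  have hsame : ∀ a b c, a ≠ b → (a ∈ P ↔ c ∈ P) → (b ∈ P ↔ c ∈ P) → ρ c < ρ a → ρ c < ρ b →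
      G.Resolved T P a b c := by
    intro a b c hab h1 h2 hca hcb
    refine Or.inl ⟨?_, ?_⟩
    · by_contra hadj
      have hadj' : G.graphᶜ.Adj a b := (SimpleGraph.compl_adj _ _ _).2 ⟨hab, hadj⟩
      by_cases hc : c ∈ P
      · rcases h.star_left a (h1.2 hc) b (h2.2 hc) hadj' with h3 | h3
        · exact hmin a c (Or.inl h3) hca
        · exact hmin b c (Or.inl h3) hcb
      · rcases h.star_right a (by tauto) b (by tauto) hadj' with h3 | h3
        · exact hmin a c (Or.inr h3) hca
        · exact hmin b c (Or.inr h3) hcb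
    · by_cases hc : c ∈ P
      · exact hT {x | x ∈ P ∧ ρ c + 1 ≤ ρ x}
          ⟨⟨a, h1.2 hc, hca⟩, Or.inr (Or.inr (Or.inl ⟨_, rfl⟩))⟩
          a ⟨h1.2 hc, hca⟩ b ⟨h2.2 hc, hcb⟩ c (fun hc' => absurd hc'.2 (by omega))
      · exact hT {x | x ∉ P ∧ ρ c + 1 ≤ ρ x}
          ⟨⟨a, by tauto, hca⟩, Or.inr (Or.inr (Or.inr ⟨_, rfl⟩))⟩
          a ⟨by tauto, hca⟩ b ⟨by tauto, hcb⟩ c (fun hc' => absurd hc'.2 (by omega))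
  refine ⟨T, G.cost_le_baseCost_add hG T P fun a b c hab hbc hac => ?_⟩
  by_cases h1 : a ∈ P ↔ b ∈ P
  · by_cases h2 : a ∈ P ↔ c ∈ P
    · have n1 : ρ a ≠ ρ b := fun hh => hab (hinj a b hh h1)
      have n2 : ρ a ≠ ρ c := fun hh => hac (hinj a c hh h2)
      have n3 : ρ b ≠ ρ c := fun hh => hbc (hinj b c hh (h1.symm.trans h2))
      rcases (by omega : (ρ c < ρ a ∧ ρ c < ρ b) ∨ (ρ a < ρ b ∧ ρ a < ρ c) ∨
        (ρ b < ρ c ∧ ρ b < ρ a)) with ⟨h3, h4⟩ | ⟨h3, h4⟩ | ⟨h3, h4⟩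
      · exact Or.inl (hsame a b c hab h2 (h1.symm.trans h2) h3 h4)
      · exact Or.inr (Or.inl (hsame b c a hbc h1.symm h2.symm h3 h4))
      · exact Or.inr (Or.inr (hsame c a b hac.symm (h2.symm.trans h1) h1 h3 h4))
    · exact Or.inl (hcross a b c hab h1 h2)
  · by_cases h2 : b ∈ P ↔ c ∈ P
    · exact Or.inr (Or.inl (hcross b c a hbc h2 (by tauto)))
    · exact Or.inr (Or.inr (hcross c a b hac.symm (by tauto) (by tauto)))

theorem NearlyBipartiteCompl.opt_eq (h : G.NearlyBipartiteCompl P KP KQ v u) (hG : G.IsUnit)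
    {k : ℕ} (hKP : k ≤ KP.card) (hKQ : k ≤ KQ.card) (hP : G.splitLoss P ≤ 2 * (k * (k - 1))) :
    G.opt = G.baseCost + (G.splitLoss P : ℝ) / 2 := by
  have hlow : ∀ T : HCTree V, G.baseCost + (G.splitLoss P : ℝ) / 2 ≤ T.cost G := by
    have : Nontrivial V := ⟨v, u, fun hvu => h.mem_right (hvu ▸ h.mem_left)⟩
    intro T
    obtain ⟨X, hne, hne', hX⟩ := G.exists_baseCost_add_le_cost hG T
    have h1 : (G.splitLoss P : ℝ) ≤ G.splitLoss X := by
      exact_mod_cast h.splitLoss_le hKP hKQ hP hne hne'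
    linarith
  obtain ⟨T, hT⟩ := h.exists_cost_le hG
  refine le_antisymm ?_ ?_
  · refine (csInf_le ⟨G.baseCost + (G.splitLoss P : ℝ) / 2, ?_⟩ (Set.mem_range_self T)).trans hT
    rintro _ ⟨T', rfl⟩
    exact hlow T'
  · refine le_csInf ⟨_, T, rfl⟩ ?_
    rintro _ ⟨T', rfl⟩
    exact hlow T'

end WeightedGraph

/-! ### The one-way communication complexity of the index problem -/

open Classical in
-- The sum factors over the coordinates, each contributing `γ` for agreement and `1` for
-- disagreement.
theorem sum_pow_agree {ι : Type*} [Fintype ι] (y : ι → Bool) (γ : ℝ) :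
    ∑ z : ι → Bool, γ ^ (Finset.univ.filter fun i => y i = z i).card =
      (1 + γ) ^ Fintype.card ι := by
  have h1 : ∀ z : ι → Bool, γ ^ (Finset.univ.filter fun i => y i = z i).card =
      ∏ i, if y i = z i then γ else 1 := fun z => by
    rw [Finset.prod_ite, Finset.prod_const, Finset.prod_const_one, mul_one]
  have h2 := Finset.prod_univ_sum (fun _ : ι => (Finset.univ : Finset Bool))
    (fun i b => if y i = b then γ else 1)
  rw [Fintype.piFinset_univ] at h2
  simp_rw [h1, ← h2]
  rw [Finset.prod_congr rfl (g := fun _ => 1 + γ), Finset.prod_const, Finset.card_univ]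
  intro i _
  cases y i <;> simp [add_comm]

open Classical in
/-- A deterministic one-way protocol for the index problem that is right on two thirds of the inputs
has at least `2 ^ (δ N)` messages. -/
theorem card_mul_log_le_of_agree {ι M : Type*} [Fintype ι] [Fintype M] (f : (ι → Bool) → M)
    (D : M → ι → Bool)
    (h : (2 / 3 : ℝ) * Fintype.card ι * 2 ^ Fintype.card ι ≤
      ∑ z : ι → Bool, ((Finset.univ.filter fun i => D (f z) i = z i).card : ℝ)) :
    Fintype.card ι * Real.log (200 / 189) ≤ Real.log (Fintype.card M) := by
  set N := Fintype.card ι with hN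
  let a : (ι → Bool) → ℕ := fun z => (Finset.univ.filter fun i => D (f z) i = z i).card
  -- The moment has base `(5/4) ^ 3`, so that the mean agreement `2N/3` gives the integer exponent
  -- `2 * N`. Per coordinate the upper bound is `1 + (5/4) ^ 3 = 189/64` and the lower bound `2 *
  -- (5/4) ^ 2`; their ratio is `200/189 > 1`.
  have hγ : (0 : ℝ) < 5 / 4 := by norm_num
  have hup : ∑ z, ((5 / 4 : ℝ) ^ 3) ^ a z ≤ Fintype.card M * (189 / 64) ^ N := by
    have h1 : ∀ z, ((5 / 4 : ℝ) ^ 3) ^ a z ≤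
        ∑ m : M, ((5 / 4 : ℝ) ^ 3) ^ (Finset.univ.filter fun i => D m i = z i).card := fun z =>
      Finset.single_le_sum
        (f := fun m => ((5 / 4 : ℝ) ^ 3) ^ (Finset.univ.filter fun i => D m i = z i).card)
        (fun _ _ => by positivity) (Finset.mem_univ (f z))
    refine (Finset.sum_le_sum fun z _ => h1 z).trans ?_
    rw [Finset.sum_comm]
    simp_rw [sum_pow_agree]
    rw [Finset.sum_const, Finset.card_univ, nsmul_eq_mul, ← hN]
    norm_num
  -- Jensen's inequality, through the tangent line of the exponential at agreement `2N/3`.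
  have hlow : (2 : ℝ) ^ N * (5 / 4) ^ (2 * N) ≤ ∑ z, ((5 / 4 : ℝ) ^ 3) ^ a z := by
    have hlog : 0 < Real.log (5 / 4) := Real.log_pos (by norm_num)
    have h1 : ∀ z, (5 / 4 : ℝ) ^ (2 * N) * (1 + Real.log (5 / 4) * (3 * a z - 2 * N)) ≤
        ((5 / 4 : ℝ) ^ 3) ^ a z := by
      intro z
      have h2 : ∀ k : ℕ, (5 / 4 : ℝ) ^ k = Real.exp (Real.log (5 / 4) * k) := fun k => by
        rw [← Real.rpow_natCast, Real.rpow_def_of_pos hγ]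
      have h3 : ((5 / 4 : ℝ) ^ 3) ^ a z =
          (5 / 4) ^ (2 * N) * Real.exp (Real.log (5 / 4) * (3 * a z - 2 * N)) := by
        rw [← pow_mul, h2, h2, ← Real.exp_add]
        congr 1
        push_cast
        ring
      rw [h3]
      refine mul_le_mul_of_nonneg_left ?_ (by positivity)
      linarith [Real.add_one_le_exp (Real.log (5 / 4) * (3 * a z - 2 * N))]
    refine le_trans ?_ (Finset.sum_le_sum fun z _ => h1 z)
    rw [← Finset.mul_sum, Finset.sum_add_distrib, ← Finset.mul_sum, Finset.sum_sub_distrib,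
      ← Finset.mul_sum]
    simp only [Finset.sum_const, Finset.card_univ, Fintype.card_pi, Fintype.card_bool,
      Finset.prod_const, nsmul_eq_mul, ← hN]
    push_cast
    rw [mul_comm]
    refine mul_le_mul_of_nonneg_left ?_ (by positivity)
    have : 0 ≤ 3 * ∑ z, (a z : ℝ) - 2 ^ N * (2 * N) := by linarith
    nlinarith [mul_nonneg hlog.le this]
  have hM : (0 : ℝ) < Fintype.card M := by
    have : Nonempty M := ⟨f fun _ => true⟩
    exact_mod_cast Fintype.card_pos
  have h4 : (200 / 189 : ℝ) ^ N ≤ Fintype.card M := by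
    have h5 := hlow.trans hup
    rw [pow_mul, ← mul_pow] at h5
    have h6 : (2 * (5 / 4 : ℝ) ^ 2) ^ N = (200 / 189) ^ N * (189 / 64) ^ N := by
      rw [← mul_pow]
      norm_num
    rw [h6] at h5
    exact le_of_mul_le_mul_right h5 (by positivity)
  have h7 := Real.log_le_log (by positivity) h4
  rwa [Real.log_pow] at h7

open Classical in
/-- A randomized one-way protocol for the index problem, with public coins, that is right with
probability two thirds on each input, has at least `2 ^ (δ N)` messages. -/
theorem card_mul_log_le_of_prob {Ω : Type*} [MeasurableSpace Ω] (μ : Measure Ω)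
    [IsProbabilityMeasure μ] {ι M : Type*} [Fintype ι] [Fintype M] (f : Ω → (ι → Bool) → M)
    (D : Ω → M → ι → Bool) (E : (ι → Bool) → ι → Set Ω) (hE : ∀ z i, MeasurableSet (E z i))
    (hprob : ∀ z i, 2 / 3 ≤ μ.real (E z i))
    (hD : ∀ z i, ∀ ω ∈ E z i, D ω (f ω z) i = z i) :
    Fintype.card ι * Real.log (200 / 189) ≤ Real.log (Fintype.card M) := by
  have hint : ∀ z i, Integrable ((E z i).indicator (1 : Ω → ℝ)) μ := fun z i =>
    (integrable_const 1).indicator (hE z i)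
  have hint' : ∀ z, Integrable (fun ω => ∑ i, (E z i).indicator (1 : Ω → ℝ) ω) μ := fun z =>
    integrable_finsetSum _ fun i _ => hint z i
  -- Some outcome of the coins does at least as well as the average over all inputs; fixing it makes
  -- the protocol deterministic.
  obtain ⟨ω, hω⟩ := exists_integral_le (μ := μ)
    (f := fun ω => ∑ z, ∑ i, (E z i).indicator (1 : Ω → ℝ) ω)
    (integrable_finsetSum _ fun z _ => hint' z)
  refine card_mul_log_le_of_agree (f ω) (D ω) (le_trans (le_trans ?_ hω) ?_)
  · rw [integral_finsetSum _ fun z _ => hint' z]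
    simp_rw [integral_finsetSum _ fun i _ => hint _ i, integral_indicator_one (hE _ _)]
    refine le_trans (le_of_eq ?_)
      (Finset.sum_le_sum fun z _ => Finset.sum_le_sum fun i _ => hprob z i)
    simp
    ring
  · refine Finset.sum_le_sum fun z _ => ?_
    rw [Finset.natCast_card_filter]
    refine Finset.sum_le_sum fun i _ => ?_
    by_cases h : ω ∈ E z i
    · simp [h, hD z i ω h]
    · rw [Set.indicator_of_notMem h]
      split_ifs <;> norm_num

/-! ### Streaming algorithms as one-way protocols -/

namespace StreamingAlgorithm

variable {X Ω : Type*} [MeasurableSpace Ω] {s : ℕ} (A : StreamingAlgorithm X Ω s)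

theorem runFrom_append (ω : Ω) (l l' : List X) (t : ℕ) (m : Memory s) :
    A.runFrom ω t m (l ++ l') = A.runFrom ω (t + l.length) (A.runFrom ω t m l) l' := by
  induction l generalizing t m with
  | nil => rfl
  | cons x l ih =>
    rw [List.cons_append, runFrom, ih, runFrom, List.length_cons]
    congr 1
    omega

theorem measurable_comp_of_countable {M β : Type*} [MeasurableSpace M] [Countable M]
    [MeasurableSingletonClass M] [MeasurableSpace β] {F : Ω → M → β}
    (hF : ∀ m, Measurable fun ω => F ω m) {g : Ω → M} (hg : Measurable g) :
    Measurable fun ω => F ω (g ω) :=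
  (measurable_from_prod_countable_left (f := fun p : Ω × M => F p.1 p.2) hF).comp
    (measurable_id.prodMk hg)

theorem measurable_runFrom (l : List X) (t : ℕ) {m : Ω → Memory s} (hm : Measurable m) :
    Measurable fun ω => A.runFrom ω t (m ω) l := by
  induction l generalizing t m with
  | nil => exact hm
  | cons x l ih =>
    exact ih (t + 1) (measurable_comp_of_countable (fun m => A.measurable_step t m x) hm)

theorem measurable_result (l : List X) : Measurable fun ω => A.result ω l :=
  measurable_comp_of_countable (fun m => A.measurable_output l.length m)
    (A.measurable_runFrom l 0 A.measurable_init)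

/-- If the output on a stream in two parts reveals the bit `z i`, where the first part depends
on `z` only and the second one on `i` only, then the memory is linear in the length of `z`. -/
theorem card_mul_log_le (μ : Measure Ω) [IsProbabilityMeasure μ] {ι : Type*} [Fintype ι]
    (l : (ι → Bool) → List X) (l' : ι → List X) (t : ℕ) (hl : ∀ z, (l z).length = t)
    (val : ι → Bool → ℝ) (hval : ∀ i, val i false ≠ val i true)
    (h : ∀ z i, 2 / 3 ≤ μ.real {ω | A.result ω (l z ++ l' i) = val i (z i)}) :
    Fintype.card ι * Real.log (200 / 189) ≤ s * Real.log 2 := by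
  classical
  -- The message is the memory after the first part. The decoder resumes from it and tests the
  -- output; it must know the number of tokens read, hence the common length `t`.
  have key := card_mul_log_le_of_prob μ
    (fun ω z => A.runFrom ω 0 (A.init ω) (l z))
    (fun ω m i => decide (A.output ω (t + (l' i).length) (A.runFrom ω t m (l' i)) = val i true))
    (fun z i => {ω | A.result ω (l z ++ l' i) = val i (z i)})
    (fun z i => A.measurable_result _ (measurableSet_singleton _)) h (by
      intro z i ω hω
      have hω' : A.result ω (l z ++ l' i) = val i (z i) := hω
      rw [result, runFrom_append, List.length_append, hl, zero_add] at hω'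
      simp only [hω']
      cases z i
      · simpa using hval i
      · simp)
  simpa [Memory] using key

end StreamingAlgorithm

namespace WeightedGraph

open Classical in
/-- The nonadjacent pairs in a class form a star. -/
theorem nonadjCard_eq_of_star {V : Type*} (G : WeightedGraph V) {X : Finset V} {v : V}
    (hv : v ∈ X) (hX : ∀ a ∈ X, ∀ b ∈ X, G.graphᶜ.Adj a b → a = v ∨ b = v) {S : Finset V}
    (hS : ∀ b, b ∈ S ↔ b ∈ X ∧ G.graphᶜ.Adj v b) : G.nonadjCard X = 2 * S.card := by
  have hvS : v ∉ S := fun h => ((hS v).1 h).2.ne rfl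
  have h1 : (X ×ˢ X).filter (fun p => G.graphᶜ.Adj p.1 p.2) = {v} ×ˢ S ∪ S ×ˢ {v} := by
    ext ⟨a, b⟩
    simp only [Finset.mem_filter, Finset.mem_product, Finset.mem_union, Finset.mem_singleton, hS]
    constructor
    · rintro ⟨⟨ha, hb⟩, h⟩
      rcases hX a ha b hb h with rfl | rfl
      · exact Or.inl ⟨rfl, hb, h⟩
      · exact Or.inr ⟨⟨ha, h.symm⟩, rfl⟩
    · rintro (⟨rfl, hb, h⟩ | ⟨⟨ha, h⟩, rfl⟩)
      · exact ⟨⟨hv, hb⟩, h⟩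
      · exact ⟨⟨ha, hv⟩, h.symm⟩
  rw [nonadjCard, h1, Finset.card_union_of_disjoint]
  · simp
    ring
  · rw [Finset.disjoint_left]
    rintro ⟨a, b⟩ h h'
    simp only [Finset.mem_product, Finset.mem_singleton] at h h'
    exact hvS (h.1 ▸ h'.1)

end WeightedGraph

/-! ### Encoding the index problem -/

namespace IndexGraph

/-- The vertices: two copies of `Fin r × Bool`, between which the bits are encoded, and two
cliques. -/
abbrev Role (r p q : ℕ) : Type := (Fin r × Bool) ⊕ (Fin r × Bool) ⊕ Fin p ⊕ Fin q

variable {r p q : ℕ}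

/-- The pairs that encode the bits. -/
def IsCode : Role r p q → Role r p q → Prop
  | .inl _, .inr (.inl _) => True
  | .inr (.inl _), .inl _ => True
  | _, _ => False

/-- The edges that encode the bits `z`. -/
def CodeAdj (z : Fin r × Fin r → Bool) : Role r p q → Role r p q → Prop
  | .inl a, .inr (.inl b) => b.2 = !xor a.2 (z (a.1, b.1))
  | .inr (.inl b), .inl a => b.2 = !xor a.2 (z (a.1, b.1))
  | _, _ => False

/-- The first of the two classes into which an optimal tree branches when the bit `i` is queried. -/
def Side (i : Fin r × Fin r) : Role r p q → Prop
  | .inl a => a ≠ (i.1, false)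
  | .inr (.inl b) => b = (i.2, false)
  | .inr (.inr (.inl _)) => True
  | .inr (.inr (.inr _)) => False

theorem CodeAdj.symm {z : Fin r × Fin r → Bool} {x y : Role r p q} (h : CodeAdj z x y) :
    CodeAdj z y x := by
  rcases x with x | x | x | x <;> rcases y with y | y | y | y <;> exact h

theorem CodeAdj.isCode {z : Fin r × Fin r → Bool} {x y : Role r p q} (h : CodeAdj z x y) :
    IsCode x y := by
  rcases x with x | x | x | x <;> rcases y with y | y | y | y <;> trivial

theorem IsCode.symm {x y : Role r p q} (h : IsCode x y) : IsCode y x := by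
  rcases x with x | x | x | x <;> rcases y with y | y | y | y <;> exact h

theorem not_isCode_self (x : Role r p q) : ¬ IsCode x x := by
  rcases x with x | x | x | x <;> exact id

variable {V : Type*} (φ : V ≃ Role r p q)

/-- The graph of the edges that encode the bits. -/
def codeGraph (z : Fin r × Fin r → Bool) : SimpleGraph V where
  Adj x y := CodeAdj z (φ x) (φ y)
  symm := ⟨fun _ _ h => h.symm⟩
  loopless := ⟨fun _ h => not_isCode_self _ h.isCode⟩

/-- The graph of the edges that query a bit. -/
def queryGraph (i : Fin r × Fin r) : SimpleGraph V where
  Adj x y := x ≠ y ∧ ¬ IsCode (φ x) (φ y) ∧ (Side i (φ x) ↔ Side i (φ y))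
  symm := ⟨fun _ _ h => ⟨h.1.symm, fun h' => h.2.1 h'.symm, h.2.2.symm⟩⟩
  loopless := ⟨fun _ h => h.1 rfl⟩

/-- The union of the code and of the query, with unit weights. -/
def graph (z : Fin r × Fin r → Bool) (i : Fin r × Fin r) : WeightedGraph V where
  graph := codeGraph φ z ⊔ queryGraph φ i
  w := 1
  w_pos := fun _ _ => one_pos

theorem graph_isUnit (z : Fin r × Fin r → Bool) (i : Fin r × Fin r) : (graph φ z i).IsUnit :=
  fun _ _ => rfl

theorem disjoint_codeGraph_queryGraph (z : Fin r × Fin r → Bool) (i : Fin r × Fin r) :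
    Disjoint (codeGraph φ z) (queryGraph φ i) := by
  rw [SimpleGraph.disjoint_left]
  exact fun x y h h' => h'.2.1 h.isCode

theorem compl_adj (z : Fin r × Fin r → Bool) (i : Fin r × Fin r) (x y : V) :
    (graph φ z i).graphᶜ.Adj x y ↔ φ x ≠ φ y ∧ ¬ CodeAdj z (φ x) (φ y) ∧
      (IsCode (φ x) (φ y) ∨ ¬ (Side i (φ x) ↔ Side i (φ y))) := by
  rw [SimpleGraph.compl_adj, φ.injective.ne_iff]
  simp only [graph, SimpleGraph.sup_adj, codeGraph, queryGraph]
  tauto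

/-- The clique in the first class. -/
def leftClique : Finset V :=
  (Finset.univ.image fun k : Fin p => (.inr (.inr (.inl k)) : Role r p q)).map φ.symm.toEmbedding

/-- The clique in the second class. -/
def rightClique : Finset V :=
  (Finset.univ.image fun k : Fin q => (.inr (.inr (.inr k)) : Role r p q)).map φ.symm.toEmbedding

theorem mem_leftClique (x : V) : x ∈ leftClique φ ↔ ∃ k, φ x = .inr (.inr (.inl k)) := by
  simp [leftClique, eq_comm]

theorem card_leftClique : (leftClique φ).card = p := by
  rw [leftClique, Finset.card_map, Finset.card_image_of_injective, Finset.card_univ,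
    Fintype.card_fin]
  intro k k' h
  simpa using h

theorem mem_rightClique (x : V) : x ∈ rightClique φ ↔ ∃ k, φ x = .inr (.inr (.inr k)) := by
  simp [rightClique, eq_comm]

theorem card_rightClique : (rightClique φ).card = q := by
  rw [rightClique, Finset.card_map, Finset.card_image_of_injective, Finset.card_univ,
    Fintype.card_fin]
  intro k k' h
  simpa using h

/-! ### The number of code edges and the partition of a query -/

section Count

variable [Fintype V]

open Classical in
-- Each vertex of the first copy is joined to exactly one of `(j, false)`, `(j, true)` for every
-- `j`. Independence of `z` keeps both the length of the first part of the stream and the base cost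
-- free of the bits.
theorem card_codeGraph (z : Fin r × Fin r → Bool) :
    (codeGraph φ z).edgeFinset.card = 2 * r ^ 2 := by
  let f : (Fin r × Bool) × Fin r → Sym2 V := fun x =>
    s(φ.symm (.inl x.1), φ.symm (.inr (.inl (x.2, !xor x.1.2 (z (x.1.1, x.2))))))
  have hf : Function.Injective f := by
    rintro ⟨a, b⟩ ⟨a', b'⟩ h
    simp only [f, Sym2.eq_iff, EmbeddingLike.apply_eq_iff_eq, Sum.inl.injEq, Sum.inr.injEq,
      Prod.mk.injEq, reduceCtorEq, false_and, or_false] at h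
    rw [h.1, h.2.1]
  have h1 : (codeGraph φ z).edgeFinset = Finset.univ.image f := by
    ext e
    induction e with
    | _ x y =>
      have hxy : ∀ x y, CodeAdj z (φ x) (φ y) ↔ ∃ t, f t = s(x, y) := by
        intro x y
        constructor
        · intro h
          rcases hx : φ x with a | a | a | a <;> rcases hy : φ y with b | b | b | b <;>
            rw [hx, hy] at h <;> try exact h.elim
          · have h' : b.2 = !xor a.2 (z (a.1, b.1)) := h
            refine ⟨(a, b.1), ?_⟩
            rw [← φ.symm_apply_apply x, ← φ.symm_apply_apply y, hx, hy]
            simp only [f, ← h']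
          · have h' : a.2 = !xor b.2 (z (b.1, a.1)) := h
            refine ⟨(b, a.1), ?_⟩
            rw [← φ.symm_apply_apply x, ← φ.symm_apply_apply y, hx, hy, Sym2.eq_swap]
            simp only [f, ← h']
        · rintro ⟨t, ht⟩
          rcases Sym2.eq_iff.1 ht with ⟨rfl, rfl⟩ | ⟨rfl, rfl⟩ <;> simp [CodeAdj]
      rw [SimpleGraph.mem_edgeFinset, Finset.mem_image]
      simp only [Finset.mem_univ, true_and]
      exact hxy x y
  rw [h1, Finset.card_image_of_injective _ hf, Finset.card_univ]
  simp
  ring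

open Classical in
/-- The first class of the partition. -/
noncomputable def left (i : Fin r × Fin r) : Finset V := Finset.univ.filter fun x => Side i (φ x)

theorem mem_left (i : Fin r × Fin r) (x : V) : x ∈ left φ i ↔ Side i (φ x) := by
  simp [left]

/-- Only code pairs can be missing inside a class. Each class holds a single vertex of one copy, the
exchanged one, so these pairs form a star; clique vertices are in no code pair and have no edge
across. -/
theorem nearlyBipartiteCompl [DecidableEq V] (z : Fin r × Fin r → Bool) (i : Fin r × Fin r) :
    (graph φ z i).NearlyBipartiteCompl (left φ i) (leftClique φ) (rightClique φ)
      (φ.symm (.inr (.inl (i.2, false)))) (φ.symm (.inl (i.1, false))) where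
  subset_left := by
    intro x hx
    obtain ⟨k, hk⟩ := (mem_leftClique φ x).1 hx
    simp [mem_left, hk, Side]
  subset_right := by
    intro x hx
    obtain ⟨k, hk⟩ := (mem_rightClique φ x).1 hx
    simp [mem_left, hk, Side]
  adj_right := by
    intro x hx y hy
    obtain ⟨k, hk⟩ := (mem_rightClique φ y).1 hy
    rw [mem_left] at hx
    rw [compl_adj, hk]
    generalize φ x = x at hx
    rcases x with x | x | x | x <;> simp_all [Side, CodeAdj, IsCode]
  adj_left := by
    intro x hx y hy
    obtain ⟨k, hk⟩ := (mem_leftClique φ x).1 hx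
    rw [Finset.mem_compl, mem_left] at hy
    rw [compl_adj, hk]
    generalize φ y = y at hy
    rcases y with y | y | y | y <;> simp_all [Side, CodeAdj, IsCode]
  mem_left := by simp [mem_left, Side]
  mem_right := by simp [mem_left, Side]
  star_left := by
    intro x hx y hy h
    rw [mem_left] at hx hy
    rw [compl_adj] at h
    obtain ⟨x, rfl⟩ := φ.symm.surjective x
    obtain ⟨y, rfl⟩ := φ.symm.surjective y
    rcases x with x | x | x | x <;> rcases y with y | y | y | y <;>
      simp_all [Side, CodeAdj, IsCode]
  star_right := by
    intro x hx y hy h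
    rw [mem_left] at hx hy
    rw [compl_adj] at h
    obtain ⟨x, rfl⟩ := φ.symm.surjective x
    obtain ⟨y, rfl⟩ := φ.symm.surjective y
    rcases x with x | x | x | x <;> rcases y with y | y | y | y <;>
      simp_all [Side, CodeAdj, IsCode]

/-- The number of nonadjacent pairs inside either class. -/
def loss (r : ℕ) (b : Bool) : ℕ := if b then r else r - 1

open Classical in
theorem card_filter_loss (i : Fin r) (b : Bool) :
    (Finset.univ.filter fun j : Fin r => ¬ (j = i ∧ b = false)).card = loss r b := by
  cases b
  · simp [loss, Finset.filter_ne']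
  · simp [loss]

end Count

/-! ### The optimal value as a function of the queried bit -/

section Value

variable [Fintype V]

/-- For each `j` the centre misses exactly `(j, z (j, i.2))`. For `j = i.1` this is the vertex moved
to the other class precisely when the queried bit is false, and then the pair is not counted. -/
theorem nonadjCard_left (z : Fin r × Fin r → Bool) (i : Fin r × Fin r) :
    (graph φ z i).nonadjCard (left φ i) = 2 * loss r (z i) := by
  classical
  have h := nearlyBipartiteCompl φ z i
  rw [WeightedGraph.nonadjCard_eq_of_star _ h.mem_left h.star_left
    (S := ((Finset.univ.filter fun j : Fin r => ¬ (j = i.1 ∧ z i = false)).image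
      fun j => (.inl (j, z (j, i.2)) : Role r p q)).map φ.symm.toEmbedding), Finset.card_map,
    Finset.card_image_of_injective _ (fun _ _ h => (Prod.mk.inj (Sum.inl.inj h)).1),
    card_filter_loss]
  intro x
  rw [mem_left, compl_adj]
  simp only [Finset.mem_map_equiv, Finset.mem_image, Finset.mem_filter, Finset.mem_univ, true_and,
    Equiv.symm_symm, Equiv.apply_symm_apply]
  generalize φ x = x
  constructor
  · rintro ⟨j, hj, rfl⟩
    refine ⟨?_, by simp, by simp [CodeAdj], Or.inl trivial⟩
    intro h'
    rw [Prod.mk.injEq] at h'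
    obtain ⟨rfl, h'⟩ := h'
    exact hj ⟨rfl, h'⟩
  · rintro ⟨hside, hne, hcode, hx⟩
    rcases x with ⟨j, b⟩ | y | y | y
    · have hb : b = z (j, i.2) := by
        have : ¬ (false = !xor b (z (j, i.2))) := hcode
        revert this
        cases b <;> cases z (j, i.2) <;> simp
      refine ⟨j, ?_, by rw [hb]⟩
      rintro ⟨rfl, h'⟩
      exact hside (by rw [hb, ← h'])
    · rcases hx with hx | hx
      · exact hx.elim
      · exact (hx (iff_of_true rfl hside)).elim
    · rcases hx with hx | hx
      · exact hx.elim
      · exact (hx (iff_of_true rfl hside)).elim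
    · exact hside.elim

theorem nonadjCard_left_compl [DecidableEq V] (z : Fin r × Fin r → Bool) (i : Fin r × Fin r) :
    (graph φ z i).nonadjCard (left φ i)ᶜ = 2 * loss r (z i) := by
  classical
  have h := nearlyBipartiteCompl φ z i
  rw [WeightedGraph.nonadjCard_eq_of_star _ (Finset.mem_compl.2 h.mem_right)
    (fun a ha b hb => h.star_right a (Finset.mem_compl.1 ha) b (Finset.mem_compl.1 hb))
    (S := ((Finset.univ.filter fun j : Fin r => ¬ (j = i.2 ∧ z i = false)).image
      fun j => (.inr (.inl (j, z (i.1, j))) : Role r p q)).map φ.symm.toEmbedding),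
    Finset.card_map,
    Finset.card_image_of_injective _ (fun _ _ h => (Prod.mk.inj (Sum.inl.inj (Sum.inr.inj h))).1),
    card_filter_loss]
  intro x
  rw [Finset.mem_compl, mem_left, compl_adj]
  simp only [Finset.mem_map_equiv, Finset.mem_image, Finset.mem_filter, Finset.mem_univ, true_and,
    Equiv.symm_symm, Equiv.apply_symm_apply]
  generalize φ x = x
  constructor
  · rintro ⟨j, hj, rfl⟩
    refine ⟨?_, by simp, by simp [CodeAdj], Or.inl trivial⟩
    intro h'
    have h' : (j, z (i.1, j)) = (i.2, false) := h'
    rw [Prod.mk.injEq] at h'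
    obtain ⟨rfl, h'⟩ := h'
    exact hj ⟨rfl, h'⟩
  · rintro ⟨hside, hne, hcode, hx⟩
    rcases x with y | ⟨j, b⟩ | y | y
    · rcases hx with hx | hx
      · exact hx.elim
      · exact (hx (iff_of_false (fun h => h rfl) hside)).elim
    · have hb : b = z (i.1, j) := by
        have : ¬ (b = !xor false (z (i.1, j))) := hcode
        revert this
        cases b <;> cases z (i.1, j) <;> simp
      refine ⟨j, ?_, by rw [hb]⟩
      rintro ⟨rfl, h'⟩
      exact hside (show (i.2, b) = (i.2, false) by rw [hb, ← h'])
    · exact (hside trivial).elim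
    · rcases hx with hx | hx
      · exact hx.elim
      · exact (hx (iff_of_false (fun h => h rfl) hside)).elim

/-- Both classes miss equally many pairs, so the sizes of the opposite classes add up to `n` and the
clique sizes drop out. -/
theorem splitLoss_left [DecidableEq V] (z : Fin r × Fin r → Bool) (i : Fin r × Fin r) :
    (graph φ z i).splitLoss (left φ i) = 2 * (loss r (z i) * Fintype.card V) := by
  rw [WeightedGraph.splitLoss, nonadjCard_left, nonadjCard_left_compl,
    ← Finset.card_add_card_compl (left φ i)]
  ring

open Classical in
/-- The optimal value when the queried bit is `b`. -/
noncomputable def value (i : Fin r × Fin r) (b : Bool) : ℝ :=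
  (Fintype.card V : ℝ) * (2 * r ^ 2 + (queryGraph φ i).edgeFinset.card : ℕ) -
    (Fintype.card V : ℝ) * (Fintype.card V - 1) * (Fintype.card V - 2) / 6 +
    loss r b * Fintype.card V

theorem value_false_ne_value_true [Nonempty V] (i : Fin r × Fin r) :
    value φ i false ≠ value φ i true := by
  intro h
  have hr : 1 ≤ r := i.1.pos
  have hV : (Fintype.card V : ℝ) ≠ 0 := by exact_mod_cast Fintype.card_ne_zero
  have h1 : (loss r false : ℝ) * Fintype.card V = loss r true * Fintype.card V := by
    unfold value at h
    linarith
  have h2 : loss r false = loss r true := by exact_mod_cast mul_right_cancel₀ hV h1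
  simp [loss] at h2
  omega

end Value


/-- The optimal value reveals the queried bit. -/
theorem opt_graph {V : Type} [Fintype V] (φ : V ≃ Role r p q) {k : ℕ} (hp : k ≤ p) (hq : k ≤ q) (hk : r * Fintype.card V ≤ k * (k - 1))
    (z : Fin r × Fin r → Bool) (i : Fin r × Fin r) :
    (graph φ z i).opt = value φ i (z i) := by
  classical
  have hloss : loss r (z i) ≤ r := by
    unfold loss
    split_ifs <;> omega
  rw [(nearlyBipartiteCompl φ z i).opt_eq (graph_isUnit φ z i) (k := k) (hp.trans (card_leftClique φ).ge)
    (hq.trans (card_rightClique φ).ge) ?_]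
  · have hE : (graph φ z i).graph.edgeFinset.card =
        2 * r ^ 2 + (queryGraph φ i).edgeFinset.card := by
      rw [← card_codeGraph φ z, ← Finset.card_union_of_disjoint]
      · congr 1
        ext e
        rw [SimpleGraph.mem_edgeFinset]
        simp [graph]
      · rw [SimpleGraph.disjoint_edgeFinset]
        exact disjoint_codeGraph_queryGraph φ z i
    rw [WeightedGraph.baseCost, splitLoss_left, value, ← hE]
    push_cast
    ring
  · rw [splitLoss_left]
    exact Nat.mul_le_mul_left 2 ((Nat.mul_le_mul_right _ hloss).trans hk)

end IndexGraph

/-! ### Assembly of the stream and choice of parameters -/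

open Classical in
/-- The concatenation of streams of two disjoint unit-weight graphs is a stream of their union. -/
theorem WeightedGraph.isStream_append {V : Type*} [Fintype V] {G : WeightedGraph V}
    {G₁ G₂ : SimpleGraph V} (hG : G.graph = G₁ ⊔ G₂) (hdisj : Disjoint G₁ G₂) :
    G.IsStream (G₁.edgeFinset.toList.map (fun e => (e, G.w e)) ++
      G₂.edgeFinset.toList.map (fun e => (e, G.w e))) := by
  refine ⟨G₁.edgeFinset.toList ++ G₂.edgeFinset.toList, ?_, ?_, by rw [List.map_append]⟩
  · rw [List.nodup_append']
    refine ⟨Finset.nodup_toList _, Finset.nodup_toList _, ?_⟩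
    have h := SimpleGraph.disjoint_edgeFinset.2 hdisj
    rw [Finset.disjoint_left] at h
    intro e h1 h2
    exact h (Finset.mem_toList.1 h1) (Finset.mem_toList.1 h2)
  · intro e
    rw [List.mem_append, Finset.mem_toList, Finset.mem_toList, SimpleGraph.mem_edgeFinset,
      SimpleGraph.mem_edgeFinset, hG, SimpleGraph.edgeSet_sup, Set.mem_union]

/-- A streaming algorithm that computes the optimal value needs memory for all the encoded bits. -/
theorem StreamingAlgorithm.ComputesOpt.sq_mul_log_le {V : Type} [Fintype V] {r p q k : ℕ}
    (φ : V ≃ IndexGraph.Role r p q) (hp : k ≤ p) (hq : k ≤ q)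
    (hk : r * Fintype.card V ≤ k * (k - 1)) {W : Set ℝ} (hW : (1 : ℝ) ∈ W)
    {Ω : Type*} [MeasurableSpace Ω] {μ : Measure Ω} [IsProbabilityMeasure μ] {s : ℕ}
    {A : StreamingAlgorithm (Sym2 V × ℝ) Ω s} (hA : A.ComputesOpt μ W (2 / 3)) :
    (r : ℝ) ^ 2 * Real.log (200 / 189) ≤ s * Real.log 2 := by
  classical
  have key := A.card_mul_log_le μ
    (fun z => (IndexGraph.codeGraph φ z).edgeFinset.toList.map fun e => (e, (1 : ℝ)))
    (fun i => (IndexGraph.queryGraph φ i).edgeFinset.toList.map fun e => (e, (1 : ℝ)))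
    (2 * r ^ 2) (fun z => by
      rw [List.length_map, Finset.length_toList]
      exact IndexGraph.card_codeGraph φ z)
    (IndexGraph.value φ)
    (fun i => by
      have : Nonempty V := ⟨φ.symm (.inl (i.1, false))⟩
      exact IndexGraph.value_false_ne_value_true φ i)
    (fun z i => by
      have h := hA (IndexGraph.graph φ z i) (fun _ _ => hW) _
        (WeightedGraph.isStream_append rfl (IndexGraph.disjoint_codeGraph_queryGraph φ z i))
      rw [IndexGraph.opt_graph φ hp hq hk z i] at h
      exact h)
  simpa [sq] using key

theorem theorem6p1 :
    ∃ c : ℝ, 0 < c ∧ ∃ n₀ : ℕ, ∀ n : ℕ, n₀ ≤ n →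
      ∀ W : Set ℝ, (1 : ℝ) ∈ W →
      ∀ (Ω : Type*) [MeasurableSpace Ω] (μ : Measure Ω) [IsProbabilityMeasure μ]
        (s : ℕ) (A : StreamingAlgorithm (Sym2 (Fin n) × ℝ) Ω s),
        A.ComputesOpt μ W (2 / 3) → c * (n : ℝ) ^ 2 ≤ (s : ℝ) := by
  have h2 : 0 < Real.log 2 := Real.log_pos (by norm_num)
  have hδ : 0 < Real.log (200 / 189) := Real.log_pos (by norm_num)
  refine ⟨Real.log (200 / 189) / (1024 * Real.log 2), by positivity, 128, ?_⟩
  intro n hn W hW Ω _ μ _ s A hA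
  -- The code takes `4 * r` vertices and the rest is halved into cliques of size at least `k`, about
  -- `3n/8`. Then `r n ≤ 3 r (k - 1) ≤ k (k - 1)`, and `n ≤ 32 r` accounts for `1024 = 32 ^ 2`.
  obtain ⟨r, hr⟩ : ∃ r, r = n / 16 := ⟨_, rfl⟩
  obtain ⟨k, hk⟩ : ∃ k, k = (n - 4 * r) / 2 := ⟨_, rfl⟩
  have hcard : Fintype.card (Fin n) = Fintype.card (IndexGraph.Role r k (n - 4 * r - k)) := by
    simp
    omega
  have hrk : r * n ≤ k * (k - 1) := by
    have h3 : n ≤ 3 * (k - 1) := by omega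
    have h4 : 3 * r ≤ k := by omega
    nlinarith [Nat.mul_le_mul h4 h3]
  have key := hA.sq_mul_log_le (Fintype.equivOfCardEq hcard) le_rfl (by omega)
    (by rwa [Fintype.card_fin]) hW
  have hrn : (n : ℝ) ≤ 32 * r := by
    have : n ≤ 32 * r := by omega
    exact_mod_cast this
  rw [div_mul_eq_mul_div, div_le_iff₀ (by positivity)]
  have h5 : (n : ℝ) ^ 2 ≤ 1024 * (r : ℝ) ^ 2 := by
    nlinarith [(Nat.cast_nonneg n : (0 : ℝ) ≤ n)]
  nlinarith [mul_le_mul_of_nonneg_left h5 hδ.le]
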